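/- For $n\in\mathbb N$ let $\mathbb{C}\langle x_{ij} : 1\le i,j\le n\rangle$ be the free unital associative complex algebra on $n^2$ variables, and let $\deg P$ be the maximal length of a monomial occurring in $P$ with non-zero coefficient. Let $I_n\subseteq\mathbb{C}\langle x_{ij}\rangle$ be the two-sided ideal generated by $$x_{ij}^2-x_{ij},\qquad \sum_{k=1}^n x_{ik}-1,\qquad \sum_{k=1}^n x_{kj}-1\qquad(1\le i,j\le n),$$ $$x_{ij}x_{ik},\qquad x_{ji}x_{ki}\qquad(1\le i,j,k\le n,\ j\ne k).$$ A matrix $M\in M_n(B)$ over a unital $C^*$-algebra $B$ is a magic unitary if $M_{ij}^2=M_{ij}^*=M_{ij}$ and $\sum_k M_{ik}=\sum_k M_{kj}=1$ for all $i,j$. A non-zero polynomial $P\in\mathbb{C}\langle x_{ij}\rangle$ is called separating for $M$ if $P(M)=0$ (substituting $x_{ij}\mapsto M_{ij}$) but $P\notin I_n$. Let $A=C^*(p,q \mid p^2=p^*=p,\ q^2=q^*=q)$ be the universal unital $C^*$-algebra generated by two projections, let $$R=\begin{pmatrix} p&0&1-p&0\\ 1-p&0&p&0\\ 0&q&0&1-q\\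 0&1-q&0&q\end{pmatrix}\in M_4(A),$$ and let $M=R^{\boxtimes 3}\in M_4(A\otimes A\otimes A)$, that is, $M_{ij}=\sum_{k,l=1}^4 R_{ik}\otimes R_{kl}\otimes R_{lj}$. **Theorem.** The matrix $M$ is a magic unitary, and there is no separating polynomial $P\in\mathbb{C}\langle x_{ij}:1\le i,j\le 4\rangle$ with $\deg P\le 50$ for $M$. Equivalently, every $P$ with $\deg P\le 50$ and $P(M)=0$ lies in $I_4$. -/

import Mathlib

open scoped ENNReal

noncomputable section

namespace QPerm

/-! ### Magic unitaries, noncommutative polynomials, the magic unitary ideal -/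

/-- A matrix over a *-ring is a magic unitary if its entries are projections and every row and
every column sums up to `1`. -/
structure IsMagicUnitary {n : ℕ} {B : Type*} [Ring B] [StarRing B]
    (M : Matrix (Fin n) (Fin n) B) : Prop where
  proj : ∀ i j, IsStarProjection (M i j)
  row_sum : ∀ i, ∑ k, M i k = 1
  col_sum : ∀ j, ∑ k, M k j = 1

/-- Noncommutative complex polynomials in the variables `x_ij`, `i, j = 1, …, n`. -/
abbrev NCPoly (n : ℕ) : Type := FreeAlgebra ℂ (Fin n × Fin n)

/-- The variable `x_ij`. -/
def x {n : ℕ} (i j : Fin n) : NCPoly n := FreeAlgebra.ι ℂ (i, j)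

/-- The degree: the maximal length of a monomial (a word in the variables) that occurs in `P`
with non-zero coefficient; the zero polynomial gets degree `0`. -/
def deg {n : ℕ} (P : NCPoly n) : ℕ :=
  (FreeAlgebra.equivMonoidAlgebraFreeMonoid P).coeff.support.sup FreeMonoid.length

/-- The substitution homomorphism `x_ij ↦ M_ij`. -/
def subst {n : ℕ} {B : Type*} [Ring B] [Algebra ℂ B] (M : Matrix (Fin n) (Fin n) B) :
    NCPoly n →ₐ[ℂ] B :=
  FreeAlgebra.lift ℂ fun ij => M ij.1 ij.2

/-- The generators of the magic unitary ideal. -/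
inductive MagicRelation (n : ℕ) : NCPoly n → Prop
  | idem (i j : Fin n) : MagicRelation n (x i j * x i j - x i j)
  | row_sum (i : Fin n) : MagicRelation n (∑ k, x i k - 1)
  | col_sum (j : Fin n) : MagicRelation n (∑ k, x k j - 1)
  | row_orth (i j k : Fin n) (h : j ≠ k) : MagicRelation n (x i j * x i k)
  | col_orth (i j k : Fin n) (h : j ≠ k) : MagicRelation n (x j i * x k i)

/-- The magic unitary ideal `I_n`, a two-sided ideal. -/
def magicIdeal (n : ℕ) : TwoSidedIdeal (NCPoly n) :=
  TwoSidedIdeal.span {P | MagicRelation n P}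

/-- `P` is a separating polynomial for the matrix `M`. -/
def IsSeparating {n : ℕ} {B : Type*} [CStarAlgebra B] (M : Matrix (Fin n) (Fin n) B)
    (P : NCPoly n) : Prop :=
  P ≠ 0 ∧ subst M P = 0 ∧ P ∉ magicIdeal n

/-! ### The universal unital C*-algebra generated by two projections

It is realized as the closed unital *-subalgebra generated by `(p_i)_i` and `(q_i)_i` in the
`ℓ^∞`-product over all unital C*-algebras `B_i` with two chosen projections `p_i`, `q_i`, so its
norm is the supremum of the norms over all such pairs. It is enough that the `B_i` range over
the C*-algebras in `Type`: a C*-algebra generated by two elements is separable, hence has at most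
continuum many elements. -/

/-- The `ℓ^∞`-product of a family of non-zero unital C*-algebras is a unital C*-algebra. -/
instance lpCStarAlgebra {I : Type*} (B : I → Type*) [∀ i, CStarAlgebra (B i)]
    [∀ i, Nontrivial (B i)] : CStarAlgebra (lp B ∞) :=
  { lp.inftyNormedRing, lp.inftyStarRing, lp.inftyNormedAlgebra with
    complete := CompleteSpace.complete
    star_smul := star_smul
    norm_mul_self_le := fun a => (CStarRing.norm_star_mul_self (x := a)).symm.le }

/-- Two projections in a non-zero unital C*-algebra (the zero algebra would contribute nothing to
the norm). -/
structure ProjPair : Type 1 where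
  carrier : Type
  [cstar : CStarAlgebra carrier]
  [nontriv : Nontrivial carrier]
  p : carrier
  q : carrier
  hp : IsStarProjection p
  hq : IsStarProjection q

attribute [instance] ProjPair.cstar ProjPair.nontriv

/-- The family `(p_i)_i`. -/
def prodP : lp (fun i : ProjPair => i.carrier) ∞ :=
  ⟨fun i => i.p, memℓp_infty ⟨1, by rintro _ ⟨i, rfl⟩; exact i.hp.norm_le⟩⟩

/-- The family `(q_i)_i`. -/
def prodQ : lp (fun i : ProjPair => i.carrier) ∞ :=
  ⟨fun i => i.q, memℓp_infty ⟨1, by rintro _ ⟨i, rfl⟩; exact i.hq.norm_le⟩⟩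

/-- The closed unital *-subalgebra generated by the two projections. -/
def twoProjSubalgebra : StarSubalgebra ℂ (lp (fun i : ProjPair => i.carrier) ∞) :=
  (StarAlgebra.adjoin ℂ {prodP, prodQ}).topologicalClosure

/-- `A = C*(p, q | p² = p* = p, q² = q* = q)`. -/
def A : Type 1 := twoProjSubalgebra

instance : CStarAlgebra A :=
  haveI : IsClosed (twoProjSubalgebra : Set (lp (fun i : ProjPair => i.carrier) ∞)) :=
    StarSubalgebra.isClosed_topologicalClosure _
  StarSubalgebra.cstarAlgebra twoProjSubalgebra

/-- The universal projection `p`. -/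
def p : A :=
  ⟨prodP, StarSubalgebra.le_topologicalClosure _ (StarAlgebra.subset_adjoin ℂ _ (by simp))⟩

/-- The universal projection `q`. -/
def q : A :=
  ⟨prodQ, StarSubalgebra.le_topologicalClosure _ (StarAlgebra.subset_adjoin ℂ _ (by simp))⟩

lemma isStarProjection_p : IsStarProjection p :=
  ⟨Subtype.ext (Subtype.ext (funext fun i => i.hp.isIdempotentElem)),
    Subtype.ext (Subtype.ext (funext fun i => i.hp.isSelfAdjoint))⟩

lemma isStarProjection_q : IsStarProjection q :=
  ⟨Subtype.ext (Subtype.ext (funext fun i => i.hq.isIdempotentElem)),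
    Subtype.ext (Subtype.ext (funext fun i => i.hq.isSelfAdjoint))⟩

/-- The universal property of `A`. -/
lemma A_exists_hom {B : Type} [CStarAlgebra B] [Nontrivial B] {p' q' : B}
    (hp : IsStarProjection p') (hq : IsStarProjection q') :
    ∃ f : A →⋆ₐ[ℂ] B, f p = p' ∧ f q = q' :=
  let i : ProjPair := ⟨B, p', q', hp, hq⟩
  ⟨{  toFun := fun a => a.1.1 i
      map_one' := rfl
      map_mul' := fun _ _ => rfl
      map_zero' := rfl
      map_add' := fun _ _ => rfl
      commutes' := fun _ => rfl
      map_star' := fun _ => rfl }, rfl, rfl⟩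

/-! ### The C*-tensor product `A ⊗ A ⊗ A`

It is realized as the universal unital C*-algebra generated by three pairwise commuting copies of
`A`, that is, as the maximal C*-tensor product, in the same way as `A` above. Since `A` is nuclear,
this is the only C*-tensor product; in any case it contains the algebraic tensor product, in which
all the elements used below lie. -/

/-- Three unital *-homomorphisms on `A` with pairwise commuting ranges. -/
structure CommTriple : Type 1 where
  carrier : Type
  [cstar : CStarAlgebra carrier]
  [nontriv : Nontrivial carrier]
  hom : Fin 3 → A →⋆ₐ[ℂ] carrier
  comm : ∀ k l, k ≠ l → ∀ a b, Commute (hom k a) (hom l b)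

attribute [instance] CommTriple.cstar CommTriple.nontriv

/-- The family of all images of `a ∈ A` under the `k`-th homomorphism. -/
def prodLeg (k : Fin 3) (a : A) : lp (fun i : CommTriple => i.carrier) ∞ :=
  ⟨fun i => i.hom k a, memℓp_infty ⟨‖a‖, by
    rintro _ ⟨i, rfl⟩; exact NonUnitalStarAlgHom.norm_apply_le (i.hom k) a⟩⟩

/-- The closed unital *-subalgebra generated by the three copies of `A`. -/
def tensorSubalgebra : StarSubalgebra ℂ (lp (fun i : CommTriple => i.carrier) ∞) :=
  (StarAlgebra.adjoin ℂ {y | ∃ k a, y = prodLeg k a}).topologicalClosure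

/-- `A ⊗ A ⊗ A`. -/
def A3 : Type 1 := tensorSubalgebra

instance : CStarAlgebra A3 :=
  haveI : IsClosed (tensorSubalgebra : Set (lp (fun i : CommTriple => i.carrier) ∞)) :=
    StarSubalgebra.isClosed_topologicalClosure _
  StarSubalgebra.cstarAlgebra tensorSubalgebra

/-- The embeddings `a ↦ a ⊗ 1 ⊗ 1`, `a ↦ 1 ⊗ a ⊗ 1`, `a ↦ 1 ⊗ 1 ⊗ a` of the three legs. -/
def leg (k : Fin 3) : A →⋆ₐ[ℂ] A3 where
  toFun a := ⟨prodLeg k a, StarSubalgebra.le_topologicalClosure _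
    (StarAlgebra.subset_adjoin ℂ _ ⟨k, a, rfl⟩)⟩
  map_one' := Subtype.ext (Subtype.ext (funext fun i => map_one (i.hom k)))
  map_mul' a b := Subtype.ext (Subtype.ext (funext fun i => map_mul (i.hom k) a b))
  map_zero' := Subtype.ext (Subtype.ext (funext fun i => map_zero (i.hom k)))
  map_add' a b := Subtype.ext (Subtype.ext (funext fun i => map_add (i.hom k) a b))
  commutes' c := Subtype.ext (Subtype.ext (funext fun i => AlgHomClass.commutes (i.hom k) c))
  map_star' a := Subtype.ext (Subtype.ext (funext fun i => map_star (i.hom k) a))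

lemma leg_commute {k l : Fin 3} (h : k ≠ l) (a b : A) : Commute (leg k a) (leg l b) :=
  Subtype.ext (Subtype.ext (funext fun i => i.comm k l h a b))

/-- The universal property of `A ⊗ A ⊗ A`. -/
lemma A3_exists_hom {B : Type} [CStarAlgebra B] [Nontrivial B] (f : Fin 3 → A →⋆ₐ[ℂ] B)
    (hf : ∀ k l, k ≠ l → ∀ a b, Commute (f k a) (f l b)) :
    ∃ F : A3 →⋆ₐ[ℂ] B, ∀ k a, F (leg k a) = f k a :=
  let i : CommTriple := ⟨B, f, hf⟩
  ⟨{  toFun := fun a => a.1.1 i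
      map_one' := rfl
      map_mul' := fun _ _ => rfl
      map_zero' := rfl
      map_add' := fun _ _ => rfl
      commutes' := fun _ => rfl
      map_star' := fun _ => rfl }, fun _ _ => rfl⟩

/-- The elementary tensor `a ⊗ b ⊗ c`. -/
def tmul (a b c : A) : A3 := leg 0 a * leg 1 b * leg 2 c

/-! ### The concrete magic unitary -/

/-- The initial magic unitary `R`. -/
def R : Matrix (Fin 4) (Fin 4) A :=
  !![p, 0, 1 - p, 0;
     1 - p, 0, p, 0;
     0, q, 0, 1 - q;
     0, 1 - q, 0, q]

/-- `M = R ⊠ R ⊠ R`, where `(M₁ ⊠ M₂)_ij = ∑ k, (M₁)_ik ⊗ (M₂)_kj`. -/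
def M : Matrix (Fin 4) (Fin 4) A3 :=
  Matrix.of fun i j => ∑ k, ∑ l, tmul (R i k) (R k l) (R l j)

end QPerm

end

namespace QPerm

noncomputable section

/-! ### Quaternion units and rotations -/

/-! In every degree, `M` satisfies only the relations in `I_4`, because the quaternionic model of
these relations is faithful and sits inside `M`. The model `pauli` sends `x_kl` to the projection
onto the line of `e_k y e_l⁻¹`, with `y` running over the unit quaternions.

Faithfulness (`IsMagic.subst_eq_zero`): the Fourier transform over the Klein four-group makes a
magic matrix a rotation matrix up to signs. Its entries commute up to characters
(`IsMagic.fourier_comm`), and permanents replace minors. The matrices `C i j` of `v ↦ e_i v e_j⁻¹`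
produce the same signs, so the signs cancel in `C i j ⊗ fourier x i j`, a rotation matrix with
commuting entries (`IsMagic.rot_comm`, `IsMagic.isRotation_rot`). A rotation fixes its unit
quaternion up to sign, so even polynomials on the sphere can be evaluated at it (`exists_evenEval`).
Evaluating the model there and contracting with a fixed vector recovers `x` (`sum_twisted`). Hence a
polynomial that vanishes in the model vanishes at every magic matrix, in particular at the generic
one modulo `I_4`.

Position inside `M`: Euler angles factor a unit quaternion into three factors on circles. Each
factor gives a two-dimensional representation of `A`, and the resulting eight-dimensional
representation of `A ⊗ A ⊗ A` contains the model at `y`, up to exchanging two columns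
(`intertwiner_apply`). So `P(M) = 0` forces the model of `P` to vanish at all real unit quaternions,
hence to be divisible by the equation of the sphere (`dvd_of_vanish_on_sphere`). -/

/-- The left multiplications by the quaternion units. -/
def leftMul : Fin 4 → Matrix (Fin 4) (Fin 4) ℤ :=
  ![1, !![0, -1, 0, 0; 1, 0, 0, 0; 0, 0, 0, -1; 0, 0, 1, 0],
    !![0, 0, -1, 0; 0, 0, 0, 1; 1, 0, 0, 0; 0, -1, 0, 0],
    !![0, 0, 0, -1; 0, 0, -1, 0; 0, 1, 0, 0; 1, 0, 0, 0]]

/-- The right multiplications by the inverses of the quaternion units. -/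
def rightMulInv : Fin 4 → Matrix (Fin 4) (Fin 4) ℤ :=
  ![1, !![0, 1, 0, 0; -1, 0, 0, 0; 0, 0, 0, -1; 0, 0, 1, 0],
    !![0, 0, 1, 0; 0, 0, 0, 1; -1, 0, 0, 0; 0, -1, 0, 0],
    !![0, 0, 0, 1; 0, 0, -1, 0; 0, 1, 0, 0; -1, 0, 0, 0]]

/-- The matrix of `v ↦ e_k * v * e_l⁻¹` for the quaternion units `e_0, …, e_3`. -/
def C (k l : Fin 4) : Matrix (Fin 4) (Fin 4) ℤ := leftMul k * rightMulInv l

/-- The character table of the Klein four-group. -/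
def χ : Fin 4 → Fin 4 → ℤ :=
  ![![1, 1, 1, 1], ![1, 1, -1, -1], ![1, -1, 1, -1], ![1, -1, -1, 1]]

/-- The addition of the Klein four-group. -/
def kadd : Fin 4 → Fin 4 → Fin 4 :=
  ![![0, 1, 2, 3], ![1, 0, 3, 2], ![2, 3, 0, 1], ![3, 2, 1, 0]]

lemma χ_mul : ∀ i j k, χ i k * χ j k = χ (kadd i j) k := by decide
lemma χ_orth : ∀ k l, ∑ i, χ i k * χ i l = if k = l then 4 else 0 := by decide
-- Quaternion units commute up to the sign `χ`, left multiplications commute with right ones, and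
-- each `C i j` is orthogonal, so transposes are inverses.
lemma C_conj : ∀ k l i j,
    C k l * C i j * (C k l).transpose * (C i j).transpose = (χ i k * χ j l) • 1 := by decide +kernel

lemma C_comm : ∀ i j k l, C i j * C k l = (χ i k * χ j l) • (C k l * C i j) := by decide +kernel


/-- Four times the rank one projection onto a unit quaternion, written in terms of the rotation it
induces. -/
def quatProj {O : Type*} [AddCommGroup O] (b : Fin 4 → Fin 4 → O) (c d : Fin 4) : O :=
  ∑ i, ∑ j, C i j c d • b i j

/-- The defining relations of the rotation group, for a matrix extended by a leading `1`. -/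
structure IsRotation {O : Type*} [Ring O] (b : Fin 4 → Fin 4 → O) : Prop where
  b00 : b 0 0 = 1
  b0 : ∀ j, j ≠ 0 → b 0 j = 0
  b0' : ∀ i, i ≠ 0 → b i 0 = 0
  r : ∀ i, i ≠ 0 → b i 1 * b i 1 + b i 2 * b i 2 + b i 3 * b i 3 = 1
  c : ∀ j, j ≠ 0 → b 1 j * b 1 j + b 2 j * b 2 j + b 3 j * b 3 j = 1
  m11 : b 2 2 * b 3 3 - b 2 3 * b 3 2 = b 1 1
  m12 : b 2 3 * b 3 1 - b 2 1 * b 3 3 = b 1 2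
  m13 : b 2 1 * b 3 2 - b 2 2 * b 3 1 = b 1 3
  m21 : b 3 2 * b 1 3 - b 3 3 * b 1 2 = b 2 1
  m22 : b 3 3 * b 1 1 - b 3 1 * b 1 3 = b 2 2
  m23 : b 3 1 * b 1 2 - b 3 2 * b 1 1 = b 2 3
  m31 : b 1 2 * b 2 3 - b 1 3 * b 2 2 = b 3 1
  m32 : b 1 3 * b 2 1 - b 1 1 * b 2 3 = b 3 2
  m33 : b 1 1 * b 2 2 - b 1 2 * b 2 1 = b 3 3

/-- The classical recovery of `4 y yᵀ` from the rotation induced by `y`. -/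
lemma IsRotation.quatProj_eq {O : Type*} [Ring O] {b : Fin 4 → Fin 4 → O} (h : IsRotation b) :
    quatProj b =
      ![![1 + b 1 1 + b 2 2 + b 3 3, b 3 2 - b 2 3, b 1 3 - b 3 1, b 2 1 - b 1 2],
        ![b 3 2 - b 2 3, 1 + b 1 1 - b 2 2 - b 3 3, b 1 2 + b 2 1, b 1 3 + b 3 1],
        ![b 1 3 - b 3 1, b 1 2 + b 2 1, 1 - b 1 1 + b 2 2 - b 3 3, b 2 3 + b 3 2],
        ![b 2 1 - b 1 2, b 1 3 + b 3 1, b 2 3 + b 3 2, 1 - b 1 1 - b 2 2 + b 3 3]] := by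
  funext c d
  fin_cases c <;> fin_cases d <;>
  simp [quatProj, Fin.sum_univ_four, C, leftMul, rightMulInv, Matrix.mul_apply, h.b00, h.b0, h.b0'] <;> abel

lemma IsRotation.quatProj_symm {O : Type*} [Ring O] {b : Fin 4 → Fin 4 → O} (h : IsRotation b)
    (c d : Fin 4) : quatProj b c d = quatProj b d c := by
  rw [h.quatProj_eq]
  fin_cases c <;> fin_cases d <;> rfl

lemma IsRotation.quatProj_trace {O : Type*} [Ring O] {b : Fin 4 → Fin 4 → O} (h : IsRotation b) :
    ∑ c, quatProj b c c = 4 := by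
  rw [h.quatProj_eq]
  simp [Fin.sum_univ_four]
  grind

/-- Rank one means vanishing 2 × 2 minors. Ordering rows and columns leaves 36 of them, each an
algebraic consequence of the rotation relations. -/
lemma IsRotation.quatProj_minor_of_lt {O : Type*} [CommRing O] {b : Fin 4 → Fin 4 → O}
    (h : IsRotation b) {p q r s : Fin 4} (hpr : p < r) (hqs : q < s) :
    quatProj b p q * quatProj b r s = quatProj b p s * quatProj b r q := by
  rw [h.quatProj_eq]
  have r1 := h.r 1 (by decide)
  have r2 := h.r 2 (by decide)
  have r3 := h.r 3 (by decide)
  have c1 := h.c 1 (by decide)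
  have c2 := h.c 2 (by decide)
  have c3 := h.c 3 (by decide)
  obtain ⟨-, -, -, -, -, m11, m12, m13, m21, m22, m23, m31, m32, m33⟩ := h
  fin_cases p <;> fin_cases r <;> first | exact absurd hpr (by decide) | skip
  all_goals fin_cases q <;> fin_cases s <;> first | exact absurd hqs (by decide) | skip
  all_goals
    simp only [Fin.zero_eta, Fin.mk_one, Fin.reduceFinMk, Matrix.cons_val]
    clear hpr hqs
    grind

lemma IsRotation.quatProj_minor {O : Type*} [CommRing O] {b : Fin 4 → Fin 4 → O}
    (h : IsRotation b) (p q r s : Fin 4) :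
    quatProj b p q * quatProj b r s = quatProj b p s * quatProj b r q := by
  rcases lt_trichotomy p r with hpr | rfl | hpr <;> rcases lt_trichotomy q s with hqs | rfl | hqs
  · exact h.quatProj_minor_of_lt hpr hqs
  · rfl
  · exact (h.quatProj_minor_of_lt hpr hqs).symm
  · exact mul_comm _ _
  · rfl
  · exact mul_comm _ _
  · rw [mul_comm, ← h.quatProj_minor_of_lt hpr hqs, mul_comm]
  · rfl
  · rw [mul_comm, h.quatProj_minor_of_lt hpr hqs, mul_comm]

end

noncomputable section

/-! ### Even polynomial functions on the sphere, and the Fourier transform of a magic matrix -/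

open MvPolynomial in
open scoped IsMulCommutative in
/-- A rank one projection `N` with commuting entries, over any algebra, is induced from the
polynomial functions on the unit sphere: there is a linear map sending a product of an even number
of coordinates to the corresponding product of entries of `N`. -/
lemma exists_evenEval {S : Type*} [Ring S] [Algebra ℂ S] (N : Fin 4 → Fin 4 → S)
    (hsymm : ∀ a b, N a b = N b a)
    (hminor : ∀ a b c d, N a b * N c d = N a d * N c b)
    (htrace : ∑ a, N a a = 1) :
    ∃ Λ : MvPolynomial (Fin 4) ℂ →ₗ[ℂ] S, Λ 1 = 1 ∧
      ∀ a b f, Λ (X a * X b * f) = N a b * Λ f := by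
  -- `Q a` models multiplication by the coordinate `y_a`, which exchanges even functions (`none`)
  -- and odd ones (`some j`, the coefficient of `y_j`): `y_a y_j = N a j`, and `y_a = ∑ j, N j a
  -- y_j` on the sphere.
  let Q : Fin 4 → Matrix (Option (Fin 4)) (Option (Fin 4)) S := fun a => Matrix.of fun i j =>
    match i, j with
    | none, some j => N a j
    | some j, none => N j a
    | _, _ => 0
  have Q00 : ∀ a, Q a none none = 0 := fun _ => rfl
  have Q01 : ∀ a j, Q a none (some j) = N a j := fun _ _ => rfl
  have Q10 : ∀ a j, Q a (some j) none = N j a := fun _ _ => rfl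
  have Q11 : ∀ a j k, Q a (some j) (some k) = 0 := fun _ _ _ => rfl
  have hnn : ∀ a b, (Q a * Q b) none none = N a b := by
    intro a b
    simp only [Matrix.mul_apply, Fintype.sum_option, Q00, Q01, Q10, mul_zero, zero_add]
    rw [Finset.sum_congr rfl fun j _ => hminor a j j b, ← Finset.mul_sum, htrace, mul_one]
  have hns : ∀ a b j, (Q a * Q b) none (some j) = 0 := by
    intro a b j
    simp [Matrix.mul_apply, Fintype.sum_option, Q00, Q11]
  have hcomm : ∀ x ∈ Set.range Q, ∀ y ∈ Set.range Q, x * y = y * x := by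
    rintro _ ⟨a, rfl⟩ _ ⟨b, rfl⟩
    ext i j
    rcases i with _ | i <;> rcases j with _ | j
    · rw [hnn, hnn, hsymm]
    · rw [hns, hns]
    · simp [Matrix.mul_apply, Fintype.sum_option, Q00, Q11]
    · simp only [Matrix.mul_apply, Fintype.sum_option, Q10, Q01, Q11, mul_zero,
        Finset.sum_const_zero, add_zero]
      rw [hminor i a b j, hminor i b a j, hsymm a b]
  have := Algebra.isMulCommutative_adjoin ℂ hcomm
  let Θ : MvPolynomial (Fin 4) ℂ →ₐ[ℂ] Matrix (Option (Fin 4)) (Option (Fin 4)) S :=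
    (Algebra.adjoin ℂ (Set.range Q)).val.comp
      (aeval fun a => ⟨Q a, Algebra.subset_adjoin (Set.mem_range_self a)⟩)
  have hΘ : ∀ a, Θ (X a) = Q a := fun a => by simp [Θ]
  refine ⟨{ toFun := fun f => Θ f none none
            map_add' := fun f g => by simp
            map_smul' := fun c f => by simp }, by simp, fun a b f => ?_⟩
  change Θ (X a * X b * f) none none = N a b * Θ f none none
  -- The `none` row of `Q a * Q b` is `N a b` followed by zeros, so an even factor splits off from
  -- the corner entry.
  rw [map_mul, map_mul, hΘ, hΘ, Matrix.mul_apply, Fintype.sum_option, hnn]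
  simp [hns]

/-- The relations of the magic unitary ideal. -/
structure IsMagic {B : Type*} [Ring B] (x : Fin 4 → Fin 4 → B) : Prop where
  row_mul : ∀ i j k, x i j * x i k = if j = k then x i j else 0
  col_mul : ∀ i j k, x j i * x k i = if j = k then x j i else 0
  row_sum : ∀ i, ∑ k, x i k = 1
  col_sum : ∀ j, ∑ k, x k j = 1

lemma IsMagic.transpose {B : Type*} [Ring B] {x : Fin 4 → Fin 4 → B} (h : IsMagic x) :
    IsMagic fun i j => x j i :=
  ⟨h.col_mul, h.row_mul, h.col_sum, h.row_sum⟩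

/-- The Fourier transform over the Klein four-group. -/
def fourier {B : Type*} [Ring B] [Algebra ℂ B] (x : Fin 4 → Fin 4 → B) (i j : Fin 4) : B :=
  (1 / 4 : ℂ) • ∑ k, ∑ l, (χ i k * χ j l) • x k l

lemma fourier_transpose {B : Type*} [Ring B] [Algebra ℂ B] (x : Fin 4 → Fin 4 → B) (i j : Fin 4) :
    fourier (fun i j => x j i) i j = fourier x j i := by
  rw [fourier, fourier, Finset.sum_comm]
  simp only [mul_comm]

lemma fourier_inversion {B : Type*} [Ring B] [Algebra ℂ B] (x : Fin 4 → Fin 4 → B) (k l : Fin 4) :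
    (1 / 4 : ℂ) • ∑ i, ∑ j, (χ i k * χ j l) • fourier x i j = x k l := by
  have h : ∀ i j, (χ i k * χ j l) • fourier x i j =
      (1 / 4 : ℂ) • ∑ k', ∑ l', ((χ i k * χ i k') * (χ j l * χ j l')) • x k' l' := by
    intro i j
    rw [fourier, smul_comm, Finset.smul_sum]
    congr 1
    refine Finset.sum_congr rfl fun k' _ => ?_
    rw [Finset.smul_sum]
    refine Finset.sum_congr rfl fun l' _ => ?_
    rw [smul_smul]
    congr 1
    ring
  simp only [h, ← Finset.smul_sum]
  have h2 : ∑ i, ∑ j, ∑ k', ∑ l', ((χ i k * χ i k') * (χ j l * χ j l')) • x k' l' =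
      ∑ k', ∑ l', ((∑ i, χ i k * χ i k') * (∑ j, χ j l * χ j l')) • x k' l' := by
    simp only [Finset.sum_mul_sum, Finset.sum_smul]
    rw [Finset.sum_congr rfl fun i _ => Finset.sum_comm, Finset.sum_comm]
    refine Finset.sum_congr rfl fun k' _ => ?_
    rw [Finset.sum_congr rfl fun i _ => Finset.sum_comm, Finset.sum_comm]
  rw [h2]
  simp only [χ_orth, mul_ite, mul_zero, ite_mul, zero_mul, ite_smul, zero_smul, Finset.sum_ite_eq,
    Finset.mem_univ, if_true]
  rw [← Int.cast_smul_eq_zsmul ℂ, smul_smul, smul_smul]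
  norm_num

/-- A row consists of orthogonal idempotents, so weighting it by characters is multiplicative in the
character. -/
lemma IsMagic.rowChar_mul {B : Type*} [Ring B] {x : Fin 4 → Fin 4 → B}
    (hx : IsMagic x) (j j' k : Fin 4) :
    (∑ l, χ j l • x k l) * ∑ l, χ j' l • x k l = ∑ l, χ (kadd j j') l • x k l := by
  simp only [Finset.sum_mul_sum, smul_mul_smul_comm, hx.row_mul, smul_ite, smul_zero,
    Finset.sum_ite_eq, Finset.mem_univ, if_true, χ_mul]

lemma fourier_eq_sum {B : Type*} [Ring B] [Algebra ℂ B] (x : Fin 4 → Fin 4 → B) (i j : Fin 4) :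
    fourier x i j = (1 / 4 : ℂ) • ∑ k, χ i k • ∑ l, χ j l • x k l := by
  simp only [fourier, Finset.smul_sum, smul_smul]

/-- Orthogonality of characters collapses the double sum over rows to its diagonal, where
`IsMagic.rowChar_mul` applies. -/
lemma IsMagic.fourier_col_mul {B : Type*} [Ring B] [Algebra ℂ B] {x : Fin 4 → Fin 4 → B}
    (hx : IsMagic x) (m j j' : Fin 4) :
    ∑ i, fourier x i j * fourier x (kadd i m) j' = fourier x m (kadd j j') := by
  obtain ⟨H, hH, hmul⟩ : ∃ H : Fin 4 → Fin 4 → B,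
      (∀ i j, fourier x i j = (1 / 4 : ℂ) • ∑ k, χ i k • H j k) ∧
      ∀ j j' k, H j k * H j' k = H (kadd j j') k :=
    ⟨fun j k => ∑ l, χ j l • x k l, fourier_eq_sum x, hx.rowChar_mul⟩
  simp only [hH, smul_mul_smul_comm, ← Finset.smul_sum, Finset.sum_mul_sum]
  have h : ∀ (k k' : Fin 4) (y : B), ∑ i, (χ i k * χ (kadd i m) k') • y =
      ((∑ i, χ i k * χ i k') * χ m k') • y := by
    intro k k' y
    rw [Finset.sum_mul, Finset.sum_smul]
    simp only [← χ_mul, mul_assoc]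
  rw [Finset.sum_comm, Finset.sum_congr rfl fun k _ => Finset.sum_comm]
  simp only [h, χ_orth, ite_mul, zero_mul, ite_smul, zero_smul, Finset.sum_ite_eq,
    Finset.mem_univ, if_true, hmul]
  simp only [mul_smul, ← Finset.smul_sum]
  rw [← Int.cast_smul_eq_zsmul ℂ 4, smul_smul, smul_smul]
  congr 1
  norm_num

lemma IsMagic.fourier_row_mul {B : Type*} [Ring B] [Algebra ℂ B] {x : Fin 4 → Fin 4 → B}
    (hx : IsMagic x) (m i i' : Fin 4) :
    ∑ j, fourier x i j * fourier x i' (kadd j m) = fourier x (kadd i i') m := by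
  simpa only [fourier_transpose] using hx.transpose.fourier_col_mul m i i'

lemma IsMagic.fourier_zero_right {B : Type*} [Ring B] [Algebra ℂ B] {x : Fin 4 → Fin 4 → B}
    (hx : IsMagic x) (i : Fin 4) :
    fourier x i 0 = if i = 0 then 1 else 0 := by
  have h0 : ∀ l, χ 0 l = 1 := by decide
  have h1 : ∀ i, ∑ k, χ i k = if i = 0 then 4 else 0 := by decide
  simp only [fourier_eq_sum, h0, one_smul, hx.row_sum, ← Finset.sum_smul, h1]
  split_ifs
  · rw [← Int.cast_smul_eq_zsmul ℂ, smul_smul]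
    norm_num
  · simp

lemma IsMagic.fourier_zero_left {B : Type*} [Ring B] [Algebra ℂ B] {x : Fin 4 → Fin 4 → B}
    (hx : IsMagic x) (j : Fin 4) :
    fourier x 0 j = if j = 0 then 1 else 0 := by
  simpa only [fourier_transpose] using hx.transpose.fourier_zero_right j

end

noncomputable section

/-! ### The twisted rotation matrix of a magic matrix -/

/-- The matrix `D ⊗ a`. -/
def kron {B : Type*} [Ring B] (D : Matrix (Fin 4) (Fin 4) ℤ) (a : B) : Matrix (Fin 4) (Fin 4) B :=
  Matrix.of fun g h => D g h • a

lemma kron_mul {B : Type*} [Ring B] (D D' : Matrix (Fin 4) (Fin 4) ℤ) (a a' : B) :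
    kron D a * kron D' a' = kron (D * D') (a * a') := by
  ext g h
  simp only [kron, Matrix.mul_apply, Matrix.of_apply, smul_mul_smul_comm, Finset.sum_smul]

lemma kron_add {B : Type*} [Ring B] (D : Matrix (Fin 4) (Fin 4) ℤ) (a a' : B) :
    kron D a + kron D a' = kron D (a + a') := by
  ext g h
  simp [kron]

lemma kron_smul {B : Type*} [Ring B] (n : ℤ) (D : Matrix (Fin 4) (Fin 4) ℤ) (a : B) :
    kron (n • D) a = kron D (n • a) := by
  ext g h
  change (n * D g h) • a = D g h • n • a
  rw [mul_comm, mul_smul]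

lemma kron_neg {B : Type*} [Ring B] (D : Matrix (Fin 4) (Fin 4) ℤ) (a : B) :
    kron (-D) a = -kron D a := by
  ext g h
  simp [kron]

lemma kron_one {B : Type*} [Ring B] : kron 1 (1 : B) = 1 := by
  ext g h
  simp [kron, Matrix.one_apply]

lemma kron_zero {B : Type*} [Ring B] (D : Matrix (Fin 4) (Fin 4) ℤ) : kron D (0 : B) = 0 := by
  ext g h
  simp [kron]

lemma sum_eq_add_of_klein {B : Type*} [AddCommMonoid B] (f : Fin 4 → B) :
    ∀ {i k : Fin 4}, i ≠ 0 → k ≠ 0 → i ≠ k → f 0 = 0 → f (kadd i k) = 0 → ∑ r, f r = f i + f k := by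
  intro i k hi hk hik h0 hik0
  fin_cases i <;> fin_cases k <;> simp_all [kadd, Fin.sum_univ_four, add_comm]

lemma kadd_cancel : ∀ i k : Fin 4, kadd i (kadd i k) = k ∧ kadd k (kadd i k) = i ∧
    kadd i i = 0 ∧ kadd i 0 = i ∧ kadd 0 i = i ∧ (kadd i k = 0 → i = k) := by decide

lemma kadd_comm : ∀ i k : Fin 4, kadd i k = kadd k i := by decide

lemma C_zero : C 0 0 = 1 := by decide
lemma C_mul_self : ∀ i j : Fin 4, i ≠ 0 → j ≠ 0 → C i j * C i j = 1 := by decide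

variable {B : Type*} [Ring B] [Algebra ℂ B] {x : Fin 4 → Fin 4 → B}

/-- In `IsMagic.fourier_col_mul` with shift `kadd i k`, the terms at `0` and `kadd i k` contain an
entry of row `0`, which vanishes off its first column. What remains is a cofactor relation with a
permanent in place of a minor. -/
lemma IsMagic.fourier_mul_add_col (hx : IsMagic x) {i k j l : Fin 4} (hi : i ≠ 0) (hk : k ≠ 0)
    (hj : j ≠ 0) (hl : l ≠ 0) (hik : i ≠ k) :
    fourier x i j * fourier x k l + fourier x k j * fourier x i l =
      fourier x (kadd i k) (kadd j l) := by
  rw [← hx.fourier_col_mul, sum_eq_add_of_klein _ hi hk hik, (kadd_cancel i k).1,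
    (kadd_cancel i k).2.1]
  · rw [hx.fourier_zero_left, if_neg hj, zero_mul]
  · rw [(kadd_cancel (kadd i k) 0).2.2.1, hx.fourier_zero_left, if_neg hl, mul_zero]

lemma IsMagic.fourier_mul_add_row (hx : IsMagic x) {i k j l : Fin 4} (hi : i ≠ 0) (hk : k ≠ 0)
    (hj : j ≠ 0) (hl : l ≠ 0) (hjl : j ≠ l) :
    fourier x i j * fourier x k l + fourier x i l * fourier x k j =
      fourier x (kadd i k) (kadd j l) := by
  simpa only [fourier_transpose] using hx.transpose.fourier_mul_add_col hj hl hi hk hjl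

/-- Within one row or column the permanent relation has right-hand side `0`, which is
anticommutation. Otherwise its row and column forms share one term, and comparing them gives
commutation. -/
lemma IsMagic.fourier_comm (hx : IsMagic x) {i k j l : Fin 4} (hi : i ≠ 0) (hk : k ≠ 0)
    (hj : j ≠ 0) (hl : l ≠ 0) :
    fourier x i j * fourier x k l = (χ i k * χ j l) • (fourier x k l * fourier x i j) := by
  have hχ : ∀ a b : Fin 4, a ≠ 0 → b ≠ 0 → χ a b = if a = b then 1 else -1 := by decide
  rw [hχ i k hi hk, hχ j l hj hl]
  by_cases hik : i = k <;> by_cases hjl : j = l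
  · simp [hik, hjl]
  · have h := hx.fourier_mul_add_row hi hk hj hl hjl
    rw [hik, (kadd_cancel k 0).2.2.1, hx.fourier_zero_left,
      if_neg fun h => hjl ((kadd_cancel j l).2.2.2.2.2 h)] at h
    simpa [hik, hjl] using eq_neg_of_add_eq_zero_left h
  · have h := hx.fourier_mul_add_col hi hk hj hl hik
    rw [hjl, (kadd_cancel l 0).2.2.1, hx.fourier_zero_right,
      if_neg fun h => hik ((kadd_cancel i k).2.2.2.2.2 h)] at h
    simpa [hik, hjl] using eq_neg_of_add_eq_zero_left h
  · have h := hx.fourier_mul_add_col hi hk hj hl hik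
    have h' := hx.fourier_mul_add_row hk hi hl hj (Ne.symm hjl)
    rw [kadd_comm k i, kadd_comm l j, ← h] at h'
    simpa [hik, hjl] using (add_right_cancel h').symm

/-- The entries of the rotation matrix twisted by quaternion units. -/
def rot (x : Fin 4 → Fin 4 → B) (i j : Fin 4) : Matrix (Fin 4) (Fin 4) B :=
  kron (C i j) (fourier x i j)

lemma IsMagic.rot_comm (hx : IsMagic x) (i j k l : Fin 4) :
    rot x i j * rot x k l = rot x k l * rot x i j := by
  have h0 : ∀ i j, rot x 0 0 * rot x i j = rot x i j * rot x 0 0 := fun i j => by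
    simp [rot, C_zero, hx.fourier_zero_left, kron_one]
  have hl : ∀ j, j ≠ 0 → rot x 0 j = 0 := fun j hj => by
    simp [rot, hx.fourier_zero_left, hj, kron_zero]
  have hr : ∀ i, i ≠ 0 → rot x i 0 = 0 := fun j hj => by
    simp [rot, hx.fourier_zero_right, hj, kron_zero]
  by_cases hi : i = 0 <;> by_cases hj : j = 0
  · rw [hi, hj, h0]
  · rw [hi, hl j hj, zero_mul, mul_zero]
  · rw [hj, hr i hi, zero_mul, mul_zero]
  by_cases hk : k = 0 <;> by_cases hl0 : l = 0
  · rw [hk, hl0, h0]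
  · rw [hk, hl l hl0, zero_mul, mul_zero]
  · rw [hl0, hr k hk, zero_mul, mul_zero]
  have hsq : ∀ a b : Fin 4, χ a b * χ a b = 1 := by decide
  rw [rot, rot, kron_mul, kron_mul, C_comm, hx.fourier_comm hi hk hj hl0, kron_smul, smul_smul,
    mul_mul_mul_comm, hsq, hsq, one_mul, one_smul]

/-- The two products of `C`s in a 2 × 2 minor are opposite, which turns the permanents of `fourier
x` into minors. Since each `C i j` with nonzero indices squares to `1`, sums of squares are
unaffected. -/
lemma IsMagic.isRotation_rot (hx : IsMagic x) : IsRotation (rot x) := by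
  have hsub : ∀ i j k l, i ≠ 0 → j ≠ 0 → k ≠ 0 → l ≠ 0 → j ≠ l →
      C i j * C k l = C (kadd i k) (kadd j l) → C i l * C k j = -C (kadd i k) (kadd j l) →
      rot x i j * rot x k l - rot x i l * rot x k j = rot x (kadd i k) (kadd j l) := by
    intro i j k l hi hj hk hl hjl h1 h2
    rw [rot, rot, rot, rot, rot, kron_mul, kron_mul, h1, h2, kron_neg, sub_neg_eq_add, kron_add,
      hx.fourier_mul_add_row hi hk hj hl hjl]
  have hsq : ∀ i j, i ≠ 0 → j ≠ 0 → rot x i j * rot x i j = kron 1 (fourier x i j * fourier x i j) :=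
    fun i j hi hj => by rw [rot, kron_mul, C_mul_self i j hi hj]
  refine ⟨?_, ?_, ?_, ?_, ?_, ?_, ?_, ?_, ?_, ?_, ?_, ?_, ?_, ?_⟩
  · simp [rot, C_zero, hx.fourier_zero_left, kron_one]
  · exact fun j hj => by simp [rot, hx.fourier_zero_left, hj, kron_zero]
  · exact fun i hi => by simp [rot, hx.fourier_zero_right, hi, kron_zero]
  · intro i hi
    have h := hx.fourier_row_mul 0 i i
    rw [Fin.sum_univ_four, hx.fourier_zero_right, if_neg hi, zero_mul, zero_add,
      (kadd_cancel i 0).2.2.1, hx.fourier_zero_left, if_pos rfl] at h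
    simp only [(kadd_cancel _ 0).2.2.2.1] at h
    rw [hsq i 1 hi (by decide), hsq i 2 hi (by decide), hsq i 3 hi (by decide), kron_add, kron_add,
      h, kron_one]
  · intro i hi
    have h := hx.fourier_col_mul 0 i i
    rw [Fin.sum_univ_four, hx.fourier_zero_left, if_neg hi, zero_mul, zero_add,
      (kadd_cancel i 0).2.2.1, hx.fourier_zero_left, if_pos rfl] at h
    simp only [(kadd_cancel _ 0).2.2.2.1] at h
    rw [hsq 1 i (by decide) hi, hsq 2 i (by decide) hi, hsq 3 i (by decide) hi, kron_add, kron_add,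
      h, kron_one]
  all_goals
    refine hsub _ _ _ _ ?_ ?_ ?_ ?_ ?_ ?_ ?_ <;> decide

end

noncomputable section

/-! ### The quaternionic model -/

open scoped IsMulCommutative in
lemma IsRotation.quatProj_minor_of_comm {S : Type*} [Ring S] {b : Fin 4 → Fin 4 → S}
    (h : IsRotation b) (hcomm : ∀ i j k l, b i j * b k l = b k l * b i j) (p q r s : Fin 4) :
    quatProj b p q * quatProj b r s = quatProj b p s * quatProj b r q := by
  let T := Set.range fun ij : Fin 4 × Fin 4 => b ij.1 ij.2
  have hT : ∀ x ∈ T, ∀ y ∈ T, x * y = y * x := by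
    rintro _ ⟨_, rfl⟩ _ ⟨_, rfl⟩
    exact hcomm _ _ _ _
  have := Algebra.isMulCommutative_adjoin ℤ hT
  let b' : Fin 4 → Fin 4 → Algebra.adjoin ℤ T := fun i j =>
    ⟨b i j, Algebra.subset_adjoin (Set.mem_range_self (i, j))⟩
  have hb' : IsRotation b' :=
    ⟨Subtype.ext h.b00, fun j hj => Subtype.ext (h.b0 j hj), fun j hj => Subtype.ext (h.b0' j hj),
      fun j hj => Subtype.ext (h.r j hj), fun j hj => Subtype.ext (h.c j hj),
      Subtype.ext h.m11, Subtype.ext h.m12, Subtype.ext h.m13, Subtype.ext h.m21,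
      Subtype.ext h.m22, Subtype.ext h.m23, Subtype.ext h.m31, Subtype.ext h.m32,
      Subtype.ext h.m33⟩
  have hq : ∀ c d, quatProj b c d = (Algebra.adjoin ℤ T).val (quatProj b' c d) := fun c d => by
    simp [quatProj, b']
  rw [hq, hq, hq, hq, ← map_mul, ← map_mul, hb'.quatProj_minor]

open MvPolynomial

/-- The coordinates of `e_k * X * e_l⁻¹` for the generic quaternion `X`. -/
def quatVec (k l a : Fin 4) : MvPolynomial (Fin 4) ℂ := ∑ c, C k l a c • X c

/-- The rank one projections onto the quaternions `e_k * X * e_l⁻¹`. -/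
def pauli (k l : Fin 4) : Matrix (Fin 4) (Fin 4) (MvPolynomial (Fin 4) ℂ) :=
  Matrix.of fun a b => quatVec k l a * quatVec k l b

variable {B : Type*} [Ring B] [Algebra ℂ B] {x : Fin 4 → Fin 4 → B}

/-- Contraction with `∑ c, e_c ⊗ e_c` forms the product `C k l * C i j * (C k l)ᵀ * (C i j)ᵀ`, a
scalar by `C_conj`. That scalar is the character in the Fourier inversion formula for `x k l`. -/
lemma sum_twisted (x : Fin 4 → Fin 4 → B) (k l a g : Fin 4) :
    ∑ c, (∑ e, ∑ f, (C k l a e * C k l c f) • ((1 / 4 : ℂ) • quatProj (rot x) e f)) g c =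
      if a = g then x k l else 0 := by
  have h : ∀ c e f, ((C k l a e * C k l c f) • ((1 / 4 : ℂ) • quatProj (rot x) e f)) g c =
      ∑ i, ∑ j, (C k l a e * C i j e f * C k l c f * C i j g c) • ((1 / 4 : ℂ) • fourier x i j) := by
    intro c e f
    simp only [quatProj, rot, kron, Matrix.smul_apply, Matrix.sum_apply, Matrix.of_apply,
      Finset.smul_sum]
    refine Finset.sum_congr rfl fun i _ => Finset.sum_congr rfl fun j _ => ?_
    rw [smul_comm (1 / 4 : ℂ) (C i j e f), smul_comm (1 / 4 : ℂ) (C i j g c), smul_smul, smul_smul]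
    congr 1
    ring
  have h2 : ∀ i j, ∑ c, ∑ e, ∑ f, C k l a e * C i j e f * C k l c f * C i j g c =
      if a = g then χ i k * χ j l else 0 := by
    intro i j
    have := congrFun (congrFun (C_conj k l i j) a) g
    simp only [Matrix.mul_apply, Matrix.transpose_apply, Finset.sum_mul, Matrix.smul_apply,
      Matrix.one_apply, smul_eq_mul, mul_ite, mul_one, mul_zero] at this
    rw [← this]
    exact Finset.sum_congr rfl fun c _ => Finset.sum_comm
  simp only [Matrix.sum_apply, h]
  have h3 : ∀ F : Fin 4 → Fin 4 → Fin 4 → Fin 4 → Fin 4 → B,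
      ∑ c, ∑ e, ∑ f, ∑ i, ∑ j, F c e f i j = ∑ i, ∑ j, ∑ c, ∑ e, ∑ f, F c e f i j := by
    intro F
    simp only [← Fintype.sum_prod_type']
    exact Fintype.sum_equiv ⟨fun p => (p.2.2.2.1, p.2.2.2.2, p.1, p.2.1, p.2.2.1),
      fun p => (p.2.2.1, p.2.2.2.1, p.2.2.2.2, p.1, p.2.1), fun _ => rfl, fun _ => rfl⟩ _ _
      fun _ => rfl
  rw [h3]
  simp only [← Finset.sum_smul, h2]
  split_ifs
  · simp only [← fourier_inversion x k l, Finset.smul_sum, smul_comm (1 / 4 : ℂ)]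
  · simp

/-- A noncommutative polynomial which vanishes on the quaternionic model of the magic unitary
relations vanishes on every solution of these relations. -/
lemma IsMagic.subst_eq_zero (hx : IsMagic x) (σ : Fin 4 → Fin 4) (P : NCPoly 4)
    (hP : ∀ a b, (∑ i, X i ^ 2 - 1) ∣ subst (Matrix.of fun i j => pauli i (σ j)) P a b) :
    subst (Matrix.of fun i j => x i (σ j)) P = 0 := by
  have hrot := hx.isRotation_rot
  have htrace : ∑ a, (1 / 4 : ℂ) • quatProj (rot x) a a = 1 := by
    have h4 : (4 : Matrix (Fin 4) (Fin 4) B) = (4 : ℂ) • 1 := by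
      rw [Algebra.smul_def, mul_one, map_ofNat]
    rw [← Finset.smul_sum, hrot.quatProj_trace, h4, smul_smul]
    norm_num
  obtain ⟨Λ, hΛ1, hΛ⟩ := exists_evenEval (fun a b => (1 / 4 : ℂ) • quatProj (rot x) a b)
    (fun a b => by rw [hrot.quatProj_symm])
    (fun a b c d => by
      simp only [smul_mul_smul_comm]
      rw [hrot.quatProj_minor_of_comm hx.rot_comm])
    htrace
  set ψ := subst (Matrix.of fun i j => pauli i (σ j)) with hψ
  set φ := subst (Matrix.of fun i j => x i (σ j)) with hφ
  -- `Λ` replaces the factor `∑ X i ^ 2` by the trace, which is `1`.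
  have hzero : ∀ f, (∑ i, X i ^ 2 - 1) ∣ f → Λ f = 0 := by
    rintro _ ⟨h, rfl⟩
    simp only [sub_mul, one_mul, Finset.sum_mul, pow_two, map_sub, map_sum, hΛ]
    rw [← Finset.sum_mul, htrace, one_mul, sub_self]
  have hgen : ∀ k l a c f, Λ (pauli k l a c * f) =
      (∑ e, ∑ f, (C k l a e * C k l c f) • ((1 / 4 : ℂ) • quatProj (rot x) e f)) * Λ f := by
    intro k l a c f
    simp only [pauli, quatVec, Matrix.of_apply, Finset.sum_mul_sum, smul_mul_smul_comm]
    simp only [Finset.sum_mul, map_sum, smul_mul_assoc, map_zsmul, hΛ]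
  -- The invariant says that the image of `P` in the model, evaluated by `Λ`, acts on `∑ b, e_b ⊗
  -- e_b` as `φ P`. Since `Λ` is multiplicative only in even factors split off on the left, the
  -- induction tracks left multiplication on an arbitrary `P`.
  let good : NCPoly 4 → Prop := fun R => ∀ P : NCPoly 4,
    (∀ a g, ∑ b, Λ (ψ P a b) g b = if a = g then φ P else 0) →
    ∀ a g, ∑ b, Λ (ψ (R * P) a b) g b = if a = g then φ (R * P) else 0
  have hgood : ∀ R, good R := by
    intro R
    induction R using FreeAlgebra.induction with
    | grade0 r =>
      intro P h a g
      rw [← Algebra.smul_def]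
      simp only [map_smul, Matrix.smul_apply, ← Finset.smul_sum, h, smul_ite, smul_zero]
    | grade1 ij =>
      intro P h a g
      have e1 : ψ (FreeAlgebra.ι ℂ ij) = pauli ij.1 (σ ij.2) := by simp [hψ, subst]
      have e2 : φ (FreeAlgebra.ι ℂ ij) = x ij.1 (σ ij.2) := by simp [hφ, subst]
      have h' : ∀ T : Fin 4 → Matrix (Fin 4) (Fin 4) B, ∑ b, ∑ c, (T c * Λ (ψ P c b)) g b =
          (∑ c, T c g c) * φ P := by
        intro T
        simp only [Matrix.mul_apply]
        rw [Finset.sum_comm, Finset.sum_mul]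
        refine Finset.sum_congr rfl fun c _ => ?_
        rw [Finset.sum_comm]
        simp only [← Finset.mul_sum, h, mul_ite, mul_zero, Finset.sum_ite_eq, Finset.mem_univ,
          if_true]
      have h'' : ∀ b, Λ ((pauli ij.1 (σ ij.2) * ψ P) a b) g b = ∑ c, ((∑ e, ∑ f,
          (C ij.1 (σ ij.2) a e * C ij.1 (σ ij.2) c f) • ((1 / 4 : ℂ) • quatProj (rot x) e f)) *
            Λ (ψ P c b)) g b := by
        intro b
        rw [Matrix.mul_apply, map_sum, Matrix.sum_apply]
        simp only [hgen]
      rw [map_mul, map_mul, e1, e2, Finset.sum_congr rfl fun b _ => h'' b, h', sum_twisted,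
        ite_mul, zero_mul]
    | mul R S hR hS =>
      intro P h
      rw [mul_assoc]
      exact hR _ (hS _ h)
    | add R S hR hS =>
      intro P h a g
      simp only [add_mul, map_add, Matrix.add_apply, Finset.sum_add_distrib, hR P h, hS P h]
      split_ifs <;> simp
  have h1 := hgood P 1 (fun a g => by
    have h1 : ∀ b, Λ (if a = b then 1 else 0) g b = if a = b then (if g = b then 1 else 0) else 0 :=
      fun b => by split_ifs <;> simp_all
    simp only [map_one, Matrix.one_apply, h1, Finset.sum_ite_eq, Finset.mem_univ, if_true, eq_comm]) 0 0
  rw [mul_one, if_pos rfl] at h1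
  rw [← h1]
  exact Finset.sum_eq_zero fun b _ => by rw [hzero _ (hP 0 b)]; rfl

end

noncomputable section

/-! ### Real points of the three-sphere -/

open MvPolynomial in
/-- A polynomial vanishing on the real unit sphere is divisible by its equation. -/
lemma dvd_of_vanish_on_sphere (f : MvPolynomial (Fin 4) ℂ)
    (hf : ∀ y : Fin 4 → ℝ, ∑ i, y i ^ 2 = 1 → eval (fun i => (y i : ℂ)) f = 0) :
    (∑ i, X i ^ 2 - 1 : MvPolynomial (Fin 4) ℂ) ∣ f := by
  let e := finSuccEquiv ℂ 3
  let r : MvPolynomial (Fin 3) ℂ := ∑ i, X i ^ 2 - 1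
  let g : Polynomial (MvPolynomial (Fin 3) ℂ) := Polynomial.X ^ 2 + Polynomial.C r
  have hg : e (∑ i, X i ^ 2 - 1) = g := by
    simp only [Fin.sum_univ_succ, map_sub, map_add, map_pow, map_one, e, g, r, finSuccEquiv_X_zero,
      finSuccEquiv_X_succ, Finset.univ_eq_empty, Finset.sum_empty, map_zero]
    ring
  have hmonic : g.Monic := Polynomial.monic_X_pow_add_C r two_ne_zero
  have hdeg : g.natDegree = 2 := Polynomial.natDegree_X_pow_add_C
  rw [← map_dvd_iff e, hg, ← Polynomial.modByMonic_eq_zero_iff_dvd hmonic]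
  -- The sphere equation is a monic quadratic in the first coordinate, so the remainder is linear in
  -- it. The points with first coordinate `t` and `-t` then kill both coefficients.
  set ρ := e f %ₘ g with hρ
  have hρdeg : ρ.natDegree < 2 := by
    rw [← hdeg]
    refine Polynomial.natDegree_modByMonic_lt _ hmonic ?_
    intro h1
    rw [h1] at hdeg
    simp at hdeg
  have hρeq : ρ = Polynomial.C (ρ.coeff 1) * Polynomial.X + Polynomial.C (ρ.coeff 0) :=
    Polynomial.eq_X_add_C_of_natDegree_le_one (by omega)
  have key : ∀ y : Fin 3 → ℝ, ∀ t : ℝ, ∑ i, y i ^ 2 + t ^ 2 = 1 →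
      eval (fun i => (y i : ℂ)) (ρ.coeff 1) * t + eval (fun i => (y i : ℂ)) (ρ.coeff 0) = 0 := by
    intro y t hyt
    have h1 := hf (Fin.cons t y) (by rw [Fin.sum_univ_succ]; simpa [add_comm] using hyt)
    have h2 : (fun i => ((Fin.cons t y : Fin 4 → ℝ) i : ℂ)) = Fin.cons (t : ℂ) (fun i => (y i : ℂ)) := by
      funext i
      refine Fin.cases ?_ (fun j => ?_) i <;> simp
    have hr : eval (fun i => (y i : ℂ)) r = -(t : ℂ) ^ 2 := by
      simp only [r, map_sub, map_sum, map_pow, eval_X, map_one]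
      have : ((∑ i, y i ^ 2 + t ^ 2 : ℝ) : ℂ) = 1 := by rw [hyt]; simp
      push_cast at this
      linear_combination this
    rw [h2, eval_eq_eval_mv_eval'] at h1
    change Polynomial.eval (t : ℂ) (Polynomial.map (eval fun i => (y i : ℂ)) (e f)) = 0 at h1
    rw [← Polynomial.modByMonic_add_div (e f) g, ← hρ, hρeq] at h1
    simpa [g, hr] using h1
  -- Three squares below `1 / 4` sum to less than `1`, so `t` and `-t` are distinct. The box is a
  -- product of infinite sets, enough to force a polynomial to be zero.
  have hsmall : ∀ y : Fin 3 → ℝ, (∀ i, y i ∈ Set.Ioo (0 : ℝ) (1 / 2)) → ∃ t : ℝ, t ≠ 0 ∧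
      ∑ i, y i ^ 2 + t ^ 2 = 1 := by
    intro y hy
    have hlt : ∑ i, y i ^ 2 < 1 := by
      have : ∀ i, y i ^ 2 < 1 / 4 := fun i => by nlinarith [(hy i).1, (hy i).2]
      rw [Fin.sum_univ_three]
      linarith [this 0, this 1, this 2]
    refine ⟨√(1 - ∑ i, y i ^ 2), (Real.sqrt_pos.2 (by linarith)).ne', ?_⟩
    rw [Real.sq_sqrt (by linarith)]
    ring
  let s : Fin 3 → Set ℂ := fun _ => (fun a : ℝ => (a : ℂ)) '' Set.Ioo (0 : ℝ) (1 / 2)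
  have hs : ∀ i, (s i).Infinite := fun _ =>
    (Set.Ioo_infinite (by norm_num)).image Complex.ofReal_injective.injOn
  have hpt : ∀ z ∈ Set.pi .univ s, eval z (ρ.coeff 1) = 0 ∧ eval z (ρ.coeff 0) = 0 := by
    intro z hz
    choose y hy hyz using fun i => hz i (Set.mem_univ i)
    obtain rfl : (fun i => (y i : ℂ)) = z := funext hyz
    obtain ⟨t, ht0, ht⟩ := hsmall y hy
    have h1 := key y t ht
    have h2 := key y (-t) (by rw [← ht]; ring)
    push_cast at h2
    have ht0' : (t : ℂ) ≠ 0 := by exact_mod_cast ht0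
    constructor
    · have : eval (fun i => (y i : ℂ)) (ρ.coeff 1) * t = 0 := by linear_combination (h1 - h2) / 2
      exact (mul_eq_zero.1 this).resolve_right ht0'
    · linear_combination (h1 + h2) / 2
  have hc1 : ρ.coeff 1 = 0 := funext_set s hs fun z hz => by rw [(hpt z hz).1, map_zero]
  have hc0 : ρ.coeff 0 = 0 := funext_set s hs fun z hz => by rw [(hpt z hz).2, map_zero]
  rw [hρeq, hc1, hc0]
  simp

/-- Euler angles: every unit quaternion is a product of three quaternions on coordinate circles. -/
lemma exists_euler_angles (y : Fin 4 → ℝ) (hy : ∑ i, y i ^ 2 = 1) :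
    ∃ c s : Fin 3 → ℝ, (∀ k, c k ^ 2 + s k ^ 2 = 1) ∧
      y = ![c 1 * (c 0 * c 2 - s 0 * s 2), c 1 * (c 0 * s 2 + s 0 * c 2),
        s 1 * (c 0 * c 2 + s 0 * s 2), s 1 * (s 0 * c 2 - c 0 * s 2)] := by
  have polar : ∀ u v : ℝ, ∃ r φ : ℝ, u = r * Real.cos φ ∧ v = r * Real.sin φ := fun u v =>
    ⟨‖(⟨u, v⟩ : ℂ)‖, Complex.arg ⟨u, v⟩, by simp [Complex.norm_mul_cos_arg],
      by simp [Complex.norm_mul_sin_arg]⟩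
  obtain ⟨r, φ, h0, h1⟩ := polar (y 0) (y 1)
  obtain ⟨r', ψ, h2, h3⟩ := polar (y 2) (y 3)
  -- The outer angles have sum `φ` and difference `ψ`; the middle factor carries the two radii.
  refine ⟨![Real.cos ((φ + ψ) / 2), r, Real.cos ((φ - ψ) / 2)],
    ![Real.sin ((φ + ψ) / 2), r', Real.sin ((φ - ψ) / 2)], ?_, ?_⟩
  · have hrr : r ^ 2 + r' ^ 2 = 1 := by
      rw [Fin.sum_univ_four, h0, h1, h2, h3] at hy
      linear_combination hy - r ^ 2 * Real.cos_sq_add_sin_sq φ - r' ^ 2 * Real.cos_sq_add_sin_sq ψ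
    intro k
    fin_cases k
    · exact Real.cos_sq_add_sin_sq _
    · exact hrr
    · exact Real.cos_sq_add_sin_sq _
  · have e1 : φ = (φ + ψ) / 2 + (φ - ψ) / 2 := by ring
    have e2 : ψ = (φ + ψ) / 2 - (φ - ψ) / 2 := by ring
    funext k
    fin_cases k
    · simp only [Fin.zero_eta, Matrix.cons_val]
      rw [h0]; nth_rw 1 [e1]; rw [Real.cos_add]
    · simp only [Fin.mk_one, Matrix.cons_val]
      rw [h1]; nth_rw 1 [e1]; rw [Real.sin_add]; ring
    · simp only [Fin.reduceFinMk, Matrix.cons_val]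
      rw [h2]; nth_rw 1 [e2]; rw [Real.cos_sub]
    · simp only [Fin.reduceFinMk, Matrix.cons_val]
      rw [h3]; nth_rw 1 [e2]; rw [Real.sin_sub]

end

noncomputable section

/-! ### Magic unitarity of `M` -/

lemma isStarProjection_sum {ι B : Type*} [Ring B] [StarRing B] (s : Finset ι) (f : ι → B)
    (hf : ∀ i, IsStarProjection (f i)) (horth : ∀ i j, i ≠ j → f i * f j = 0) :
    IsStarProjection (∑ i ∈ s, f i) := by
  classical
  induction s using Finset.induction_on with
  | empty => simp [IsStarProjection.zero]
  | insert i s hi ih =>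
    rw [Finset.sum_insert hi]
    refine (hf i).add ih ?_
    rw [Finset.mul_sum]
    exact Finset.sum_eq_zero fun j hj => horth i j fun h => hi (h ▸ hj)

lemma isMagicUnitary_R : IsMagicUnitary R := by
  have hp := isStarProjection_p
  have hq := isStarProjection_q
  refine ⟨fun i j => ?_, fun i => ?_, fun j => ?_⟩
  · fin_cases i <;> fin_cases j <;>
      simp [R, hp, hq, hp.one_sub, hq.one_sub, IsStarProjection.zero]
  · fin_cases i <;> simp [R, Fin.sum_univ_four]
  · fin_cases j <;> simp [R, Fin.sum_univ_four]

lemma R_row_orthogonal (i j k : Fin 4) (h : j ≠ k) : R i j * R i k = 0 := by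
  have hp := isStarProjection_p
  have hq := isStarProjection_q
  fin_cases i <;> fin_cases j <;> fin_cases k <;>
    simp [R, hp.mul_one_sub_self, hp.one_sub_mul_self, hq.mul_one_sub_self, hq.one_sub_mul_self]
      at h ⊢

lemma tmul_mul (a b c a' b' c' : A) :
    tmul a b c * tmul a' b' c' = tmul (a * a') (b * b') (c * c') := by
  have h1 := leg_commute (show (2 : Fin 3) ≠ 0 by decide) c a'
  have h2 := leg_commute (show (2 : Fin 3) ≠ 1 by decide) c b'
  have h3 := leg_commute (show (1 : Fin 3) ≠ 0 by decide) b a'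
  simp only [tmul, map_mul]
  calc leg 0 a * leg 1 b * leg 2 c * (leg 0 a' * leg 1 b' * leg 2 c')
      = leg 0 a * leg 1 b * (leg 2 c * leg 0 a') * leg 1 b' * leg 2 c' := by noncomm_ring
    _ = leg 0 a * (leg 1 b * leg 0 a') * (leg 2 c * leg 1 b') * leg 2 c' := by
      rw [h1.eq]; noncomm_ring
    _ = _ := by rw [h2.eq, h3.eq]; noncomm_ring

lemma isStarProjection_tmul {a b c : A} (ha : IsStarProjection a) (hb : IsStarProjection b)
    (hc : IsStarProjection c) : IsStarProjection (tmul a b c) := by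
  have h01 := leg_commute (show (0 : Fin 3) ≠ 1 by decide) a b
  have h02 := leg_commute (show (0 : Fin 3) ≠ 2 by decide) a c
  have h12 := leg_commute (show (1 : Fin 3) ≠ 2 by decide) b c
  exact ((ha.map (leg 0)).mul (hb.map (leg 1)) h01).mul (hc.map (leg 2)) (h02.mul_left h12)

lemma sum_mul_mul_of_row_sum {ι B : Type*} [Fintype ι] [Semiring B] (a b c : ι → ι → B)
    (ha : ∀ i, ∑ k, a i k = 1) (hb : ∀ i, ∑ k, b i k = 1) (hc : ∀ i, ∑ k, c i k = 1) (i : ι) :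
    ∑ j, ∑ k, ∑ l, a i k * b k l * c l j = 1 := by
  rw [Finset.sum_comm, ← ha i]
  refine Finset.sum_congr rfl fun k _ => ?_
  rw [Finset.sum_comm]
  simp only [← Finset.mul_sum, hb, hc, mul_one]

lemma sum_mul_mul_of_col_sum {ι B : Type*} [Fintype ι] [Semiring B] (a b c : ι → ι → B)
    (ha : ∀ j, ∑ k, a k j = 1) (hb : ∀ j, ∑ k, b k j = 1) (hc : ∀ j, ∑ k, c k j = 1) (j : ι) :
    ∑ i, ∑ k, ∑ l, a i k * b k l * c l j = 1 := by
  rw [Finset.sum_comm, Finset.sum_congr rfl fun k _ => Finset.sum_comm, Finset.sum_comm, ← hc j]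
  refine Finset.sum_congr rfl fun l _ => ?_
  simp only [← Finset.sum_mul, ha, hb, one_mul]

lemma isMagicUnitary_M : IsMagicUnitary M := by
  have hR := isMagicUnitary_R
  refine ⟨fun i j => ?_, fun i => ?_, fun j => ?_⟩
  · simp only [M, Matrix.of_apply, ← Fintype.sum_prod_type']
    refine isStarProjection_sum _ _
      (fun kl => isStarProjection_tmul (hR.proj _ _) (hR.proj _ _) (hR.proj _ _)) ?_
    rintro ⟨k, l⟩ ⟨k', l'⟩ h
    rw [tmul_mul]
    -- Orthogonality comes from the first leg if `k ≠ k'`, and otherwise from the second.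
    by_cases hk : k = k'
    · subst hk
      have hl : l ≠ l' := fun hl => h (by rw [hl])
      simp [R_row_orthogonal k l l' hl, tmul]
    · simp [R_row_orthogonal i k k' hk, tmul]
  · exact sum_mul_mul_of_row_sum (fun i k => leg 0 (R i k)) (fun k l => leg 1 (R k l))
      (fun l j => leg 2 (R l j)) (fun i => by rw [← map_sum, hR.row_sum, map_one])
      (fun i => by rw [← map_sum, hR.row_sum, map_one])
      (fun i => by rw [← map_sum, hR.row_sum, map_one]) i
  · exact sum_mul_mul_of_col_sum (fun i k => leg 0 (R i k)) (fun k l => leg 1 (R k l))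
      (fun l j => leg 2 (R l j)) (fun i => by rw [← map_sum, hR.col_sum, map_one])
      (fun i => by rw [← map_sum, hR.col_sum, map_one])
      (fun i => by rw [← map_sum, hR.col_sum, map_one]) j

end

noncomputable section

/-! ### Finite-dimensional representations of `A ⊗ A ⊗ A` -/

open scoped Kronecker Matrix.Norms.L2Operator

/-- The orthogonal projection onto the line through a real unit vector. -/
def lineProj (u v : ℝ) : Matrix (Fin 2) (Fin 2) ℂ := !![(u : ℂ) * u, u * v; u * v, v * v]

lemma isStarProjection_lineProj {u v : ℝ} (h : u ^ 2 + v ^ 2 = 1) :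
    IsStarProjection (lineProj u v) := by
  have h' : (u : ℂ) ^ 2 + (v : ℂ) ^ 2 = 1 := by exact_mod_cast h
  constructor
  · ext i j
    fin_cases i <;> fin_cases j <;> simp [lineProj]
    · linear_combination (u : ℂ) ^ 2 * h'
    · linear_combination (u : ℂ) * v * h'
    · linear_combination (u : ℂ) * v * h'
    · linear_combination (v : ℂ) ^ 2 * h'
  · ext i j
    fin_cases i <;> fin_cases j <;> simp [lineProj, Matrix.star_apply]

/-- Unit vectors spanning the ranges of the entries of `R` in its two-dimensional
representations. -/
def circVec (c s : ℂ) : Fin 4 → Fin 4 → Fin 2 → ℂ :=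
  ![![![c, s], 0, ![-s, c], 0], ![![-s, c], 0, ![c, s], 0],
    ![0, ![c, -s], 0, ![s, c]], ![0, ![s, c], 0, ![c, -s]]]

/-- The universal property sends `p` and `q` to the lines through the mirrored vectors `(c, s)` and
`(c, -s)`; their complements are the perpendicular lines. -/
lemma exists_hom_circVec {c s : ℝ} (h : c ^ 2 + s ^ 2 = 1) :
    ∃ f : A →⋆ₐ[ℂ] Matrix (Fin 2) (Fin 2) ℂ,
      ∀ i j g k, f (R i j) g k = circVec c s i j g * circVec c s i j k := by
  obtain ⟨f, hp, hq⟩ := A_exists_hom (isStarProjection_lineProj h)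
    (isStarProjection_lineProj (u := c) (v := -s) (by rw [← h]; ring))
  refine ⟨f, fun i j g k => ?_⟩
  have h' : (c : ℂ) ^ 2 + (s : ℂ) ^ 2 = 1 := by exact_mod_cast h
  have h1 : 1 - lineProj c s = lineProj (-s) c := by
    ext g k
    fin_cases g <;> fin_cases k <;> simp [lineProj]
    · linear_combination -h'
    · ring
    · ring
    · linear_combination -h'
  have h2 : 1 - lineProj c (-s) = lineProj s c := by
    ext g k
    fin_cases g <;> fin_cases k <;> simp [lineProj]
    · linear_combination -h'
    · ring
    · ring
    · linear_combination -h'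
  fin_cases i <;> fin_cases j <;>
    simp only [R, Fin.zero_eta, Fin.mk_one, Fin.reduceFinMk, Matrix.of_apply, Matrix.cons_val,
      map_sub, map_one, map_zero, hp, hq, h1, h2, circVec] <;>
    fin_cases g <;> fin_cases k <;> simp [lineProj, mul_comm]

/-- The three embeddings of the `2 × 2` matrices into the `8 × 8` matrices. -/
def matLeg (k : Fin 3) : Matrix (Fin 2) (Fin 2) ℂ →⋆ₐ[ℂ]
    Matrix ((Fin 2 × Fin 2) × Fin 2) ((Fin 2 × Fin 2) × Fin 2) ℂ where
  toFun a := ((if k = 0 then a else 1) ⊗ₖ (if k = 1 then a else 1)) ⊗ₖ (if k = 2 then a else 1)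
  map_one' := by simp
  map_mul' a b := by
    rw [← Matrix.mul_kronecker_mul, ← Matrix.mul_kronecker_mul]
    split_ifs <;> simp
  map_zero' := by fin_cases k <;> simp
  map_add' a b := by fin_cases k <;> simp [Matrix.kronecker_add, Matrix.add_kronecker]
  commutes' r := by
    fin_cases k <;>
      simp [Algebra.algebraMap_eq_smul_one, Matrix.smul_kronecker, Matrix.kronecker_smul]
  map_star' a := by
    simp only [Matrix.star_eq_conjTranspose, Matrix.conjTranspose_kronecker]
    fin_cases k <;> simp

lemma matLeg_commute (k l : Fin 3) (h : k ≠ l) (a b : Matrix (Fin 2) (Fin 2) ℂ) :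
    Commute (matLeg k a) (matLeg l b) := by
  change (_ ⊗ₖ _) ⊗ₖ _ * (_ ⊗ₖ _) ⊗ₖ _ = (_ ⊗ₖ _) ⊗ₖ _ * (_ ⊗ₖ _) ⊗ₖ _
  rw [← Matrix.mul_kronecker_mul, ← Matrix.mul_kronecker_mul, ← Matrix.mul_kronecker_mul,
    ← Matrix.mul_kronecker_mul]
  fin_cases k <;> fin_cases l <;> simp at h ⊢

lemma matLeg_mul (a b c : Matrix (Fin 2) (Fin 2) ℂ) :
    matLeg 0 a * matLeg 1 b * matLeg 2 c = (a ⊗ₖ b) ⊗ₖ c := by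
  change ((a ⊗ₖ 1) ⊗ₖ 1) * ((1 ⊗ₖ b) ⊗ₖ 1) * ((1 ⊗ₖ 1) ⊗ₖ c) = (a ⊗ₖ b) ⊗ₖ c
  simp only [← Matrix.mul_kronecker_mul, mul_one, one_mul]

lemma exists_hom_M {c s : Fin 3 → ℝ} (h : ∀ k, c k ^ 2 + s k ^ 2 = 1) :
    ∃ F : A3 →⋆ₐ[ℂ] Matrix ((Fin 2 × Fin 2) × Fin 2) ((Fin 2 × Fin 2) × Fin 2) ℂ,
      ∀ i j g g', F (M i j) g g' = ∑ k, ∑ l,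
        (circVec (c 0) (s 0) i k g.1.1 * circVec (c 0) (s 0) i k g'.1.1) *
        (circVec (c 1) (s 1) k l g.1.2 * circVec (c 1) (s 1) k l g'.1.2) *
        (circVec (c 2) (s 2) l j g.2 * circVec (c 2) (s 2) l j g'.2) := by
  choose f hf using fun k => exists_hom_circVec (h k)
  obtain ⟨F, hF⟩ := A3_exists_hom (fun k => (matLeg k).comp (f k))
    fun k l hkl a b => matLeg_commute k l hkl _ _
  refine ⟨F, fun i j g g' => ?_⟩
  simp only [M, tmul, Matrix.of_apply, map_sum, map_mul, hF, StarAlgHom.comp_apply, matLeg_mul,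
    Matrix.sum_apply, Matrix.kroneckerMap_apply, hf]

end

noncomputable section

/-! ### The quaternionic model inside `M` -/

/-- The product of the three quaternions `c 0 + s 0 i`, `c 1 + s 1 j` and `c 2 + s 2 i`. -/
def eulerQuat {K : Type*} [CommRing K] (c s : Fin 3 → K) : Fin 4 → K :=
  ![c 1 * (c 0 * c 2 - s 0 * s 2), c 1 * (c 0 * s 2 + s 0 * c 2),
    s 1 * (c 0 * c 2 + s 0 * s 2), s 1 * (s 0 * c 2 - c 0 * s 2)]

/-- The coordinates of `e_k * y * e_l⁻¹`. -/
def unitConj (y : Fin 4 → ℂ) : Fin 4 → Fin 4 → Fin 4 → ℂ :=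
  ![![![y 0, y 1, y 2, y 3], ![y 1, -y 0, -y 3, y 2], ![y 2, y 3, -y 0, -y 1],
      ![y 3, -y 2, y 1, -y 0]],
    ![![-y 1, y 0, -y 3, y 2], ![y 0, y 1, -y 2, -y 3], ![-y 3, y 2, y 1, -y 0],
      ![y 2, y 3, y 0, y 1]],
    ![![-y 2, y 3, y 0, -y 1], ![y 3, y 2, y 1, y 0], ![y 0, -y 1, y 2, -y 3],
      ![-y 1, -y 0, y 3, y 2]],
    ![![-y 3, -y 2, y 1, y 0], ![-y 2, y 3, -y 0, y 1], ![y 1, y 0, y 3, y 2],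
      ![y 0, -y 1, -y 2, y 3]]]

lemma eval_quatVec (y : Fin 4 → ℂ) (k l a : Fin 4) :
    MvPolynomial.eval y (quatVec k l a) = unitConj y k l a := by
  fin_cases k <;> fin_cases l <;> fin_cases a <;>
    simp [quatVec, unitConj, C, leftMul, rightMulInv, Matrix.mul_apply, Fin.sum_univ_four]

/-- The exchange of the two middle indices. -/
def swapMid : Fin 4 → Fin 4 := ![0, 2, 1, 3]

/-- An intertwiner from the quaternionic model to `M`. -/
def intertwiner : Matrix ((Fin 2 × Fin 2) × Fin 2) (Fin 4) ℂ := Matrix.of fun g =>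
  (![![![![1, 0, 0, 0], ![0, 1, 0, 0]], ![![0, 0, 1, 0], ![0, 0, 0, -1]]],
    ![![![0, 1, 0, 0], ![-1, 0, 0, 0]], ![![0, 0, 0, 1], ![0, 0, 1, 0]]]] :
    Fin 2 → Fin 2 → Fin 2 → Fin 4 → ℂ) g.1.1 g.1.2 g.2

/-- This makes the intertwiner injective, so vanishing on its range passes to the model. -/
lemma transpose_intertwiner_mul :
    intertwiner.transpose * intertwiner = (2 : ℂ) • 1 := by
  ext a b
  fin_cases a <;> fin_cases b <;>
    simp [intertwiner, Matrix.mul_apply, Fintype.sum_prod_type] <;> norm_num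

-- The range of the intertwiner is invariant under the representation of `M`, which acts there as
-- the model at the Euler quaternion. Entrywise this is a polynomial identity in `c` and `s`, true
-- without `c ^ 2 + s ^ 2 = 1`.
set_option maxHeartbeats 4000000 in
lemma intertwiner_apply (c s : Fin 3 → ℂ) (i j : Fin 4) (g : (Fin 2 × Fin 2) × Fin 2)
    (d : Fin 4) :
    ∑ h, (∑ k, ∑ l,
        (circVec (c 0) (s 0) i k g.1.1 * circVec (c 0) (s 0) i k h.1.1) *
        (circVec (c 1) (s 1) k l g.1.2 * circVec (c 1) (s 1) k l h.1.2) *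
        (circVec (c 2) (s 2) l j g.2 * circVec (c 2) (s 2) l j h.2)) * intertwiner h d =
      ∑ e, intertwiner g e * (unitConj (eulerQuat c s) i (swapMid j) e *
        unitConj (eulerQuat c s) i (swapMid j) d) := by
  obtain ⟨⟨g1, g2⟩, g3⟩ := g
  fin_cases i <;> fin_cases j <;>
  · simp only [circVec, Fin.sum_univ_four, Fin.zero_eta, Fin.mk_one, Fin.reduceFinMk,
      Matrix.cons_val, Pi.zero_apply, mul_zero, zero_mul, add_zero, zero_add,
      Fintype.sum_prod_type, Fin.sum_univ_two, unitConj, eulerQuat, swapMid, intertwiner,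
      Matrix.of_apply]
    fin_cases g1 <;> fin_cases g2 <;> fin_cases g3 <;> fin_cases d <;>
      simp only [Fin.zero_eta, Fin.mk_one, Fin.reduceFinMk, Matrix.cons_val, mul_zero, zero_mul,
        add_zero, zero_add, mul_one, one_mul] <;> ring

lemma algHom_subst {n : ℕ} {B B' : Type*} [Ring B] [Algebra ℂ B] [Ring B'] [Algebra ℂ B']
    (f : B →ₐ[ℂ] B') (N : Matrix (Fin n) (Fin n) B) (P : NCPoly n) :
    f (subst N P) = subst (N.map f) P := by
  have : f.comp (subst N) = subst (N.map f) := by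
    ext ij
    simp [subst]
  exact DFunLike.congr_fun this P

/-- Intertwiners of magic matrices intertwine all noncommutative polynomials. -/
lemma subst_mul_intertwiner {n : ℕ} {K L : Type*} [Fintype K] [Fintype L] [DecidableEq K]
    [DecidableEq L] (N : Matrix (Fin n) (Fin n) (Matrix K K ℂ))
    (N' : Matrix (Fin n) (Fin n) (Matrix L L ℂ)) (V : Matrix K L ℂ)
    (h : ∀ i j, N i j * V = V * N' i j) (P : NCPoly n) : subst N P * V = V * subst N' P := by
  induction P using FreeAlgebra.induction with
  | grade0 r => simp [Algebra.algebraMap_eq_smul_one]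
  | grade1 ij => simpa [subst] using h ij.1 ij.2
  | mul P Q hP hQ =>
    rw [map_mul, map_mul, Matrix.mul_assoc, hQ, ← Matrix.mul_assoc, hP, Matrix.mul_assoc]
  | add P Q hP hQ => rw [map_add, map_add, Matrix.add_mul, Matrix.mul_add, hP, hQ]

open MvPolynomial in
lemma eval_subst_pauli_eq_zero {P : NCPoly 4} (hP : subst M P = 0) (y : Fin 4 → ℝ)
    (hy : ∑ i, y i ^ 2 = 1) (a b : Fin 4) :
    eval (fun i => (y i : ℂ)) (subst (Matrix.of fun i j => pauli i (swapMid j)) P a b) = 0 := by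
  obtain ⟨c, s, hcs, rfl⟩ := exists_euler_angles y hy
  obtain ⟨F, hF⟩ := exists_hom_M hcs
  set z : Fin 4 → ℂ := eulerQuat (fun k => (c k : ℂ)) (fun k => (s k : ℂ)) with hz
  have hz' : (fun i => ((![c 1 * (c 0 * c 2 - s 0 * s 2), c 1 * (c 0 * s 2 + s 0 * c 2),
      s 1 * (c 0 * c 2 + s 0 * s 2), s 1 * (s 0 * c 2 - c 0 * s 2)] : Fin 4 → ℝ) i : ℂ)) = z := by
    funext i
    fin_cases i <;> simp [hz, eulerQuat]
  rw [hz']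
  have h0 : subst (M.map F) P = 0 := by
    have := algHom_subst F.toAlgHom M P
    rw [hP, map_zero] at this
    exact this.symm
  have hev : ∀ p : MvPolynomial (Fin 4) ℂ, aeval z p = eval z p := fun p =>
    DFunLike.congr_fun (coe_aeval_eq_eval z) p
  have h1 := subst_mul_intertwiner (M.map F)
    ((Matrix.of fun i j => pauli i (swapMid j)).map (aeval z).mapMatrix) intertwiner (by
      intro i j
      ext g d
      have := intertwiner_apply (fun k => (c k : ℂ)) (fun k => (s k : ℂ)) i j g d
      simpa only [Matrix.mul_apply, Matrix.map_apply, hF, Matrix.of_apply, AlgHom.mapMatrix_apply,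
        pauli, map_mul, hev, eval_quatVec, ← hz] using this) P
  rw [h0, Matrix.zero_mul, ← algHom_subst] at h1
  have h2 := congrArg (intertwiner.transpose * ·) h1
  simp only [Matrix.mul_zero, ← Matrix.mul_assoc, transpose_intertwiner_mul, Matrix.smul_mul,
    Matrix.one_mul] at h2
  have h3 := (smul_eq_zero.1 h2.symm).resolve_left two_ne_zero
  have h4 := congrFun (congrFun h3 a) b
  simpa [AlgHom.mapMatrix_apply, hev] using h4

lemma IsMagic.comp {B : Type*} [Ring B] {x : Fin 4 → Fin 4 → B} (h : IsMagic x)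
    {σ : Fin 4 → Fin 4} (hσ : Function.Bijective σ) : IsMagic fun i j => x i (σ j) :=
  ⟨fun i j k => by simp only [h.row_mul, hσ.injective.eq_iff], fun i j k => h.col_mul _ _ _,
    fun i => by rw [hσ.sum_comp fun k => x i k, h.row_sum], fun j => h.col_sum _⟩

/-- The variables satisfy the magic unitary relations modulo the magic unitary ideal. -/
lemma isMagic_mk : IsMagic fun i j => ((x i j : NCPoly 4) : (magicIdeal 4).ringCon.Quotient) := by
  have h : ∀ P : NCPoly 4, MagicRelation 4 P → (P : (magicIdeal 4).ringCon.Quotient) = 0 :=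
    fun P hP => (RingCon.eq _).2 (TwoSidedIdeal.subset_span hP)
  refine ⟨fun i j k => ?_, fun i j k => ?_, fun i => ?_, fun j => ?_⟩
  · split_ifs with hjk
    · subst hjk
      exact sub_eq_zero.1 (h _ (.idem i j))
    · exact h _ (.row_orth i j k hjk)
  · split_ifs with hjk
    · subst hjk
      exact sub_eq_zero.1 (h _ (.idem j i))
    · exact h _ (.col_orth i j k hjk)
  · have := h _ (.row_sum i)
    simpa [sub_eq_zero] using this
  · have := h _ (.col_sum j)
    simpa [sub_eq_zero] using this

/-- The magic unitary `M` satisfies only the relations in the magic unitary ideal. -/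
lemma mem_magicIdeal_of_subst_M_eq_zero {P : NCPoly 4} (hP : subst M P = 0) :
    P ∈ magicIdeal 4 := by
  have hσ : Function.Bijective swapMid := by decide
  -- The generic magic matrix is taken with its columns already swapped; the swap in the model
  -- undoes this, as `swapMid` is an involution.
  have h := (isMagic_mk.comp hσ).subst_eq_zero swapMid P fun a b =>
    dvd_of_vanish_on_sphere _ fun y hy => eval_subst_pauli_eq_zero hP y hy a b
  have hσσ : ∀ j, swapMid (swapMid j) = j := by decide
  simp only [hσσ] at h
  let π : NCPoly 4 →ₐ[ℂ] (magicIdeal 4).ringCon.Quotient :=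
    { (magicIdeal 4).ringCon.mk' with commutes' := fun _ => rfl }
  have hπ : subst (Matrix.of fun i j => ((x i j : NCPoly 4) : (magicIdeal 4).ringCon.Quotient)) = π := by
    ext ij
    simp [subst]
    rfl
  rw [hπ] at h
  exact (RingCon.eq _).1 h

end

end QPerm

theorem theorem3p3 :
    QPerm.IsMagicUnitary QPerm.M ∧
    (¬ ∃ P : QPerm.NCPoly 4, QPerm.deg P ≤ 50 ∧ QPerm.IsSeparating QPerm.M P) ∧
    (∀ P : QPerm.NCPoly 4, QPerm.deg P ≤ 50 → QPerm.subst QPerm.M P = 0 →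
      P ∈ QPerm.magicIdeal 4) :=
  ⟨QPerm.isMagicUnitary_M,
    fun ⟨_, _, _, hP, hI⟩ => hI (QPerm.mem_magicIdeal_of_subst_M_eq_zero hP),
    fun _ _ hP => QPerm.mem_magicIdeal_of_subst_M_eq_zero hP⟩
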